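/- **Theorem (Liveness of streamlined HotStuff-1).** Consider $\mathbf n\ge 3\mathbf f+1$ replicas, at most $\mathbf f$ of them Byzantine, with unforgeable signatures and ideal $(\mathbf n,\mathbf n-\mathbf f)$ threshold signatures, in a partially synchronous network: there are a known $\Delta>0$ and an unknown time GST such that a message sent at time $t$ between correct replicas arrives by $\max(t,\mathrm{GST})+\Delta$; local computation takes no time. Replica $v \bmod \mathbf n$ leads view $v$, and view $0$ is the genesis view. *Protocol.* Every replica keeps a highest known certificate, of view $v_{lp}$; initially it is the genesis certificate. Whenever a correct replica moves to a later view $u$, it first sends the leader of $u$ a NewView message with its highest known certificate, and with its signature share for the proposal of view $u-1$ if it has just voted for it. The leader $L_v$, having entered view $v$ and received NewView messages for $v$ from $\mathbf n-\mathbf f$ replicas, waits until it can form a certificate $C_{v-1}$ from $\mathbf n-\mathbf f$ shares, or has such messages from all $\mathbf n$ replicas, or its share timer ($3\Delta$ after its scheduled start of view $v$) has expired. Then it broadcasts a block $B_v$ that extends the highest certificate among its own, the ones received in these NewView messages and the one it formed; this becomes its highest known certificate. $B_v$ consists of an initial segment (nonempty if possible), in order of arrival, of the transactions that $L_v$ has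 received and that are not yet in the chain it extends. A replica in view $v$ processes the first valid proposal $(B_v,C_w)$ of $L_v$ as follows: if $C_w$ extends $C_{w-1}$, it commits all blocks up to and including $B_{w-1}$ to its global ledger; it applies the speculation rules to its local ledger; if $w\ge v_{lp}$, it votes and adopts $C_w$ as its highest known certificate; then it exits view $v$. It also exits a view when its timer expires. *Pacemaker and timer.* Suppose that from some view $v_s\ge1$ on, for each view $v\ge v_s$, the scheduled starts of $v$ at the correct replicas are at or after GST and less than $2\Delta$ apart; every correct replica enters $v$ no later than its scheduled start; and, unless it processes the proposal of $L_v$, it does not leave $v$ before its timer, which expires $\tau$ after its scheduled start, where $\tau\ge 6\Delta$. Then in every execution: 1. Every transaction that is received (as a client request) by all correct replicas is eventually, and permanently, committed by every correct replica. 2. For this it suffices that the transaction is received by one correct replica that leads a view $v$ such that $L_v,L_{v+1},L_{v+2}$ are all correct. 3. There are arbitrarily large views $v$ for which $L_v,L_{v+1},L_{v+2}$ are all correct. 4. If $v\ge v_s$ and $L_v,L_{v+1},L_{v+2}$ are correct, then $L_v$ proposes a block $B_v$ in view $v$, and every correct replica processes a proposal of view $v+2$, after which $B_v$ is in its global ledger.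 -/

import Mathlib

namespace HotStuff1

/-- A block `B_v` proposed in view `v`, with its transactions and the block `parent` whose
certificate the proposal carries. Hashes are collision resistant and the proposal determines the
certificate it extends, so a block is identified with this data. `genesis` is the hard-coded block
of view `0`, whose certificate everybody accepts.

A certificate is the statement that a quorum signed a block. It is represented by the block it
certifies, and its validity is the predicate `Execution.Certified` below. Hence "the certificate
of `b` extends the certificate of `c`" in one step means `b.parent = c`. -/
inductive Block (Tx : Type*) where
  | genesis : Block Tx
  | node (view : ℕ) (txs : List Tx) (parent : Block Tx) : Block Tx

namespace Block

variable {Tx : Type*}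

/-- The view in which a block is proposed. -/
def view : Block Tx → ℕ
  | genesis => 0
  | node v _ _ => v

/-- The transactions in a block. -/
def txs : Block Tx → List Tx
  | genesis => []
  | node _ t _ => t

/-- The block whose certificate the proposal carries. -/
def parent : Block Tx → Block Tx
  | genesis => genesis
  | node _ _ p => p

/-- All blocks from the genesis block up to and including the given block. -/
def chain : Block Tx → List (Block Tx)
  | genesis => [genesis]
  | node v t p => chain p ++ [node v t p]

/-- All transactions of the blocks up to and including the given block. -/
def chainTxs : Block Tx → List Tx
  | genesis => []
  | node _ t p => chainTxs p ++ t

end Block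

/-- The static data: `n` replicas of which at most `f` are faulty, the bound `Δ` on transmission
delays, the view timer length `τ` and the global stabilization time. -/
structure System where
  n : ℕ
  f : ℕ
  three_f_lt : 3 * f + 1 ≤ n
  faulty : Finset (Fin n)
  card_faulty : faulty.card ≤ f
  Δ : ℝ
  Δ_pos : 0 < Δ
  τ : ℝ
  GST : ℝ

namespace System

/-- A replica that is not faulty. -/
def Correct (S : System) (R : Fin S.n) : Prop := R ∉ S.faulty

/-- Round-robin rotation: replica `v mod n` leads view `v`. -/
def leader (S : System) (v : ℕ) : Fin S.n :=
  ⟨v % S.n, Nat.mod_lt _ (lt_of_lt_of_le (Nat.succ_pos _) S.three_f_lt)⟩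

/-- The leaders of views `v`, `v + 1`, `v + 2` are all correct. -/
def ThreeCorrectLeaders (S : System) (v : ℕ) : Prop :=
  S.Correct (S.leader v) ∧ S.Correct (S.leader (v + 1)) ∧ S.Correct (S.leader (v + 2))

end System

/-- The messages. `propose b` carries the block `b` and the certificate of `b.parent`.
`newView v c share` is addressed to the leader of view `v`; it carries the highest certificate `c`
known to the sender and the sender's signature share for a block of view `v - 1`, or no share. -/
inductive Msg (Tx : Type*) where
  | propose (b : Block Tx) : Msg Tx
  | newView (v : ℕ) (c : Block Tx) (share : Option (Block Tx)) : Msg Tx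

/-- Local state of a replica. -/
structure LocalState (n : ℕ) (Tx : Type*) where
  /-- the current view -/
  view : ℕ
  /-- whether the pacemaker has let the replica enter its current view -/
  entered : Bool
  /-- whether the replica has proposed, as leader, in its current view -/
  proposed : Bool
  /-- the highest known certificate -/
  high : Block Tx
  globalLedger : List (Block Tx)
  localLedger : List (Block Tx)
  /-- client transactions received, in order of arrival -/
  pool : List Tx
  /-- messages received, with their senders -/
  inbox : Set (Fin n × Msg Tx)

/-- What a correct replica can do in one step. -/
inductive Action (n : ℕ) (Tx : Type*) where
  /-- a client request arrives -/
  | request (T : Tx) : Action n Tx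
  /-- a message arrives from the given sender -/
  | receive (sender : Fin n) (m : Msg Tx) : Action n Tx
  /-- the pacemaker lets the replica enter view `v` -/
  | enter (v : ℕ) : Action n Tx
  /-- as leader, broadcast a block with these transactions that extends the certificate `c` -/
  | propose (txs : List Tx) (c : Block Tx) : Action n Tx
  /-- process the leader's proposal of the current view, then exit the view -/
  | handle (b : Block Tx) : Action n Tx
  /-- the timer of the current view expires -/
  | timeout : Action n Tx

namespace LocalState

variable {n : ℕ} {Tx : Type*}

/-- The state in which every replica starts: in the genesis view, knowing the genesis block. -/
def initial (n : ℕ) (Tx : Type*) : LocalState n Tx where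
  view := 0
  entered := true
  proposed := false
  high := Block.genesis
  globalLedger := [Block.genesis]
  localLedger := [Block.genesis]
  pool := []
  inbox := ∅

/-- `T` is in the global ledger, i.e. the replica has committed `T`. -/
def Commits (s : LocalState n Tx) (T : Tx) : Prop := ∃ b ∈ s.globalLedger, T ∈ b.txs

open Classical in
/-- The replicas from which a `newView` message for the current view has arrived. -/
noncomputable def newViewSenders (s : LocalState n Tx) : Finset (Fin n) :=
  Finset.univ.filter fun i => ∃ c share, (i, Msg.newView s.view c share) ∈ s.inbox

open Classical in
/-- The replicas from which a share for `b` has arrived in a `newView` message for the current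
view. -/
noncomputable def shareSenders (s : LocalState n Tx) (b : Block Tx) : Finset (Fin n) :=
  Finset.univ.filter fun i => ∃ c, (i, Msg.newView s.view c (some b)) ∈ s.inbox

/-- The replica can combine `n - f` received shares into a certificate of the preceding view. -/
def Forms (f : ℕ) (s : LocalState n Tx) (b : Block Tx) : Prop :=
  b.view + 1 = s.view ∧ n - f ≤ (s.shareSenders b).card

/-- The certificates a leader can extend: its own highest one, those received in `newView` messages
for its view, and one that it forms itself. -/
def Known (f : ℕ) (s : LocalState n Tx) (c : Block Tx) : Prop :=
  c = s.high ∨ (∃ i share, (i, Msg.newView s.view c share) ∈ s.inbox) ∨ s.Forms f c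

open Classical in
/-- The received transactions that are yet to be proposed on the branch ending in `c`. -/
noncomputable def pending (s : LocalState n Tx) (c : Block Tx) : List Tx :=
  s.pool.filter fun T => T ∉ c.chainTxs

open Classical in
/-- Append to a ledger the blocks up to and including `b` that it does not contain yet. -/
noncomputable def commitUpTo (ledger : List (Block Tx)) (b : Block Tx) : List (Block Tx) :=
  ledger ++ b.chain.filter fun c => c ∉ ledger

open Classical in
/-- Commit rule on a proposal `b` that carries a certificate `C_w`: if `C_w` extends `C_{w-1}`,
commit all blocks up to and including `B_{w-1}`. -/
noncomputable def ledgerAfter (s : LocalState n Tx) (b : Block Tx) : List (Block Tx) :=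
  if b.parent.parent.view + 1 = b.parent.view then
    commitUpTo s.globalLedger b.parent.parent
  else s.globalLedger

open Classical in
/-- Speculation on a proposal `b` of view `v` that carries a certificate `C_w`: if `w = v - 1` and
the predecessor of `B_w` is in the global ledger, roll the local ledger back to the common ancestor
and execute up to `B_w`. -/
noncomputable def localLedgerAfter (s : LocalState n Tx) (b : Block Tx) : List (Block Tx) :=
  if b.parent.view + 1 = b.view ∧ b.parent.parent ∈ s.ledgerAfter b then b.parent.chain
  else s.localLedger

/-- Voting rule: the certificate in the proposal is not lower than the highest known one. -/
def Accepts (s : LocalState n Tx) (b : Block Tx) : Prop := s.high.view ≤ b.parent.view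

open Classical in
/-- The highest known certificate after processing the proposal `b`. -/
noncomputable def highAfter (s : LocalState n Tx) (b : Block Tx) : Block Tx :=
  if s.Accepts b then b.parent else s.high

open Classical in
/-- The share for the proposal `b` sent to the next leader. -/
noncomputable def shareFor (s : LocalState n Tx) (b : Block Tx) : Option (Block Tx) :=
  if s.Accepts b then some b else none

/-- The state after an action. -/
noncomputable def next (s : LocalState n Tx) : Action n Tx → LocalState n Tx
  | .request T => { s with pool := s.pool ++ [T] }
  | .receive i m => { s with inbox := insert (i, m) s.inbox }
  | .enter v =>
      { s with
        view := v
        entered := true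
        proposed := false }
  | .propose _ c =>
      { s with
        proposed := true
        high := c }
  | .handle b =>
      { s with
        view := s.view + 1
        entered := false
        proposed := false
        high := s.highAfter b
        globalLedger := s.ledgerAfter b
        localLedger := s.localLedgerAfter b }
  | .timeout =>
      { s with
        view := s.view + 1
        entered := false
        proposed := false }

/-- The messages sent by an action, with their receivers. Whenever a replica moves to a later view
it sends a `newView` message to the leader of that view, with a share if it voted in the view it
leaves, and without one otherwise. -/
noncomputable def sends (S : System) (s : LocalState S.n Tx) :
    Action S.n Tx → Set (Fin S.n × Msg Tx)
  | .request _ => ∅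
  | .receive _ _ => ∅
  | .enter v => {p | s.view < v ∧ p = (S.leader v, Msg.newView v s.high none)}
  | .propose txs c => {p | p.2 = Msg.propose (Block.node s.view txs c)}
  | .handle b =>
      {(S.leader (s.view + 1), Msg.newView (s.view + 1) (s.highAfter b) (s.shareFor b))}
  | .timeout => {(S.leader (s.view + 1), Msg.newView (s.view + 1) s.high none)}

/-- Replica `R` has to propose at time `t`: it leads its current view, has entered it and has not
proposed in it, has `n - f` `newView` messages for it, and can form a certificate of the preceding
view, or has `n` `newView` messages, or its share timer, `3Δ` after `start`, has expired. -/
def ProposeReady (S : System) (R : Fin S.n) (s : LocalState S.n Tx) (start t : ℝ) : Prop :=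
  R = S.leader s.view ∧ 1 ≤ s.view ∧ s.entered = true ∧ s.proposed = false ∧
    S.n - S.f ≤ s.newViewSenders.card ∧
    ((∃ b, s.Forms S.f b) ∨ s.newViewSenders.card = S.n ∨ start + 3 * S.Δ ≤ t)

/-- What a leader may propose: it extends a highest certificate it knows, and its block consists of
pending transactions taken in order of arrival, as many as it likes but at least one if there is
one. -/
def ProposeChoice (f : ℕ) (s : LocalState n Tx) (txs : List Tx) (c : Block Tx) : Prop :=
  s.Known f c ∧ (∀ c', s.Known f c' → c'.view ≤ c.view) ∧
    ∃ m : ℕ, 1 ≤ m ∧ txs = (s.pending c).take m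

/-- The proposal `b` of the leader of the current view, which has been entered, has arrived. -/
def HandleReady (S : System) (s : LocalState S.n Tx) (b : Block Tx) : Prop :=
  s.entered = true ∧ b.view = s.view ∧ (S.leader s.view, Msg.propose b) ∈ s.inbox

end LocalState

/-- A candidate run: at step `k`, at time `time k`, either nothing happens or one correct replica
performs an action. `state k R` is the state of `R` just before step `k`. Faulty replicas have no
state; they act through the messages that correct replicas receive from them. `start R v` is the
time at which the pacemaker of `R` schedules the start of view `v`. -/
structure Trace (S : System) (Tx : Type*) where
  time : ℕ → ℝ
  state : ℕ → Fin S.n → LocalState S.n Tx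
  act : ℕ → Option (Fin S.n × Action S.n Tx)
  start : Fin S.n → ℕ → ℝ

namespace Trace

variable {S : System} {Tx : Type*}

/-- At step `k`, replica `i` sends message `m` to replica `j`. -/
def Sends (E : Trace S Tx) (k : ℕ) (i j : Fin S.n) (m : Msg Tx) : Prop :=
  ∃ a, E.act k = some (i, a) ∧ (j, m) ∈ (E.state k i).sends S a

/-- Before step `k`, replica `i` has released its signature share for the block `b`. -/
def Voted (E : Trace S Tx) (k : ℕ) (i : Fin S.n) (b : Block Tx) : Prop :=
  ∃ k' < k, ∃ j v c, E.Sends k' i j (Msg.newView v c (some b))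

open Classical in
/-- A valid certificate for `b` can exist at step `k`: `b` is the genesis block, or shares of
`n - f` replicas are available. Faulty replicas sign anything; the share of a correct replica
cannot be forged. -/
def Certified (E : Trace S Tx) (k : ℕ) (b : Block Tx) : Prop :=
  b = Block.genesis ∨
    S.n - S.f ≤ (Finset.univ.filter fun i => i ∈ S.faulty ∨ E.Voted k i b).card

/-- Correct replicas only accept well-formed messages: a proposal comes from the leader of its view
and carries a valid certificate of a lower view; a `newView` message carries a valid certificate of
a lower view. -/
def WellFormed (E : Trace S Tx) (k : ℕ) (i : Fin S.n) : Msg Tx → Prop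
  | .propose b => i = S.leader b.view ∧ b.parent.view < b.view ∧ E.Certified k b.parent
  | .newView v c _ => c.view < v ∧ E.Certified k c

/-- Replica `R` is allowed to perform the action at step `k`. -/
def Allowed (E : Trace S Tx) (k : ℕ) (R : Fin S.n) : Action S.n Tx → Prop
  | .request _ => True
  | .receive i m => E.WellFormed k i m ∧ (S.Correct i → ∃ k' < k, E.Sends k' i R m)
  | .enter v =>
      (E.state k R).view < v ∨ ((E.state k R).view = v ∧ (E.state k R).entered = false)
  | .propose txs c =>
      (E.state k R).ProposeReady S R (E.start R (E.state k R).view) (E.time k) ∧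
        (E.state k R).ProposeChoice S.f txs c
  | .handle b => (E.state k R).HandleReady S b
  | .timeout =>
      (E.state k R).entered = true ∧ E.start R (E.state k R).view + S.τ ≤ E.time k

/-- Executions of the streamlined protocol in the partially synchronous network. -/
structure IsExecution (E : Trace S Tx) : Prop where
  /-- every correct replica starts in the initial state -/
  initial : ∀ R, S.Correct R → E.state 0 R = LocalState.initial S.n Tx
  /-- only allowed actions of correct replicas occur -/
  allowed : ∀ k R a, E.act k = some (R, a) → S.Correct R ∧ E.Allowed k R a
  /-- the acting replica follows the protocol -/
  step : ∀ k R a, E.act k = some (R, a) → E.state (k + 1) R = (E.state k R).next a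
  /-- the other correct replicas keep their state -/
  frame : ∀ k R, S.Correct R → (∀ a, E.act k ≠ some (R, a)) → E.state (k + 1) R = E.state k R
  time_mono : Monotone E.time
  time_unbounded : Filter.Tendsto E.time Filter.atTop Filter.atTop
  /-- messages between correct replicas arrive within `Δ` once the network is stable -/
  delivery : ∀ k i j m, S.Correct i → S.Correct j → E.Sends k i j m →
    ∃ k' > k, E.act k' = some (j, Action.receive i m) ∧ E.time k' ≤ max (E.time k) S.GST + S.Δ
  /-- no time passes while a correct leader has to propose -/
  propose_urgent : ∀ k R t, S.Correct R → E.time k ≤ t →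
    (E.state (k + 1) R).ProposeReady S R (E.start R (E.state (k + 1) R).view) t →
    E.time (k + 1) ≤ t
  /-- no time passes while a correct replica has a proposal of its current view to process -/
  handle_urgent : ∀ k R b, S.Correct R → (E.state (k + 1) R).HandleReady S b →
    E.time (k + 1) ≤ E.time k

/-- The pacemaker guarantee: from view `vs` on, which starts after GST, all correct replicas
schedule the start of each view within less than `2Δ` of each other, each of them enters the view
by its scheduled start (possibly earlier), and, unless it processes the leader's proposal, does not
leave the view before its timer, of length `τ` from the scheduled start, expires. (For timeouts the
last part is already in `Allowed`.) -/
structure SynchronizedFrom (E : Trace S Tx) (vs : ℕ) : Prop where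
  after_gst : ∀ v ≥ vs, ∀ R, S.Correct R → S.GST ≤ E.start R v
  aligned : ∀ v ≥ vs, ∀ R R', S.Correct R → S.Correct R' →
    E.start R' v < E.start R v + 2 * S.Δ
  enters : ∀ v ≥ vs, ∀ R, S.Correct R →
    ∃ k, E.act k = some (R, Action.enter v) ∧ E.time k ≤ E.start R v
  stays : ∀ k R w, E.act k = some (R, Action.enter w) → vs ≤ (E.state k R).view →
    (E.state k R).entered = true → E.start R (E.state k R).view + S.τ ≤ E.time k

/-- Replica `R` receives the client transaction `T` at some point. -/
def Receives (E : Trace S Tx) (R : Fin S.n) (T : Tx) : Prop :=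
  ∃ k, E.act k = some (R, Action.request T)

/-- Every correct replica eventually commits `T`, for good. -/
def EventuallyCommitted (E : Trace S Tx) (T : Tx) : Prop :=
  ∀ R, S.Correct R → ∃ K, ∀ k ≥ K, (E.state k R).Commits T

end Trace

end HotStuff1

/-!
The argument has a timing part, which yields votes, and a counting part, which turns votes into
certificates and ledger entries.

*Timing.* Let view `v` be synchronized and its leader `L` correct. On moving to `v`, at the latest at
its own scheduled start, every correct replica sends `L` a `newView` message. Since the scheduled
starts are less than `2Δ` apart, all of these messages arrive before the share timer of `L` expires,
`3Δ` after its scheduled start; by then `L` has proposed (`IsExecution.exists_proposes`). The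
proposal arrives within another `Δ`, still before the view timer of any correct replica, so everybody
processes it. At the time of the proposal, `L` either can form a certificate of view `v - 1`, the
highest conceivable one, or has the `newView` messages of all correct replicas
(`IsExecution.forms_or_newViews`). In both cases its proposal carries a certificate at least as high
as the one of any correct replica, and all correct replicas vote for it (`IsExecution.allVote`).

*Counting.* A quorum contains a correct replica, and a correct replica votes at most once per view.
Hence, if all correct replicas vote for a block `B` of view `v`, it is the only block of view `v`
that can be certified (`AllVote.eq_of_certified`), and a correct leader of view `v + 1`, which gets
all the shares for `B` or forms a certificate earlier, extends `B` (`AllVote.parent_eq`). So three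
correct leaders in a row propose a path `B_v`, `B_{v+1}`, `B_{v+2}`, and `B_v` is committed on
processing `B_{v+2}`. After processing `B_{v+1}` all correct replicas know the certificate of `B_v`
and refuse lower ones, so every certified block from view `v` on lies on the branch of `B_v`
(`AllVote.chainTxs_subset`).

*Transactions.* Leaders rotate with period `n`, so a correct leader followed by two correct leaders
returns to this position in arbitrarily late synchronized views. Whenever it does, its proposal takes
up the oldest transaction of its pool that is not in the chain yet, and this is never undone. A
transaction in its pool has only finitely many predecessors there, so it is committed eventually
(`IsExecution.eventuallyCommitted`).
-/

namespace HotStuff1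

/-! ### Blocks, quorums and ledgers -/

namespace Block

variable {Tx : Type*}

theorem self_mem_chain (b : Block Tx) : b ∈ b.chain := by
  cases b <;> simp [chain]

theorem exists_mem_chain_of_mem_chainTxs {T : Tx} :
    ∀ {b : Block Tx}, T ∈ b.chainTxs → ∃ d ∈ b.chain, T ∈ d.txs
  | genesis, h => by simp [chainTxs] at h
  | node v t p, h => by
    rcases List.mem_append.1 h with h | h
    · obtain ⟨d, hd, hT⟩ := exists_mem_chain_of_mem_chainTxs h
      exact ⟨d, List.mem_append_left _ hd, hT⟩
    · exact ⟨node v t p, self_mem_chain _, h⟩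

theorem chainTxs_parent_subset (b : Block Tx) : b.parent.chainTxs ⊆ b.chainTxs := by
  cases b with
  | genesis => exact List.Subset.refl _
  | node v t p => exact List.subset_append_left _ _

end Block

namespace System

variable (S : System)

theorem n_pos : 0 < S.n := lt_of_lt_of_le (Nat.succ_pos _) S.three_f_lt

theorem leader_add_mul (v m : ℕ) : S.leader (v + S.n * m) = S.leader v := by
  simp [leader]

theorem ThreeCorrectLeaders.add_mul {S : System} {v : ℕ} (h : S.ThreeCorrectLeaders v) (m : ℕ) :
    S.ThreeCorrectLeaders (v + S.n * m) := by
  have key (j : ℕ) : S.leader (v + S.n * m + j) = S.leader (v + j) := by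
    rw [Nat.add_right_comm, leader_add_mul]
  simpa only [ThreeCorrectLeaders, key, leader_add_mul] using h

theorem leader_injOn (a : ℕ) : Set.InjOn (fun i => S.leader (a + i)) (Finset.range S.n) := by
  intro i hi j hj hij
  simp only [leader, Fin.mk.injEq] at hij
  have hi' : i < S.n := by simpa using hi
  have hj' : j < S.n := by simpa using hj
  exact (Nat.ModEq.add_left_cancel' a hij).eq_of_lt_of_lt hi' hj'

/-- Each faulty replica spoils at most three of `n > 3f` consecutive views. -/
theorem exists_threeCorrectLeaders (N : ℕ) : ∃ v ≥ N, S.ThreeCorrectLeaders v := by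
  by_contra! hno
  let A (j : ℕ) : Finset ℕ := (Finset.range S.n).filter fun i => S.leader (N + j + i) ∈ S.faulty
  have hA (j : ℕ) : (A j).card ≤ S.f := by
    refine le_trans (Finset.card_le_card_of_injOn (fun i => S.leader (N + j + i)) ?_ ?_)
      S.card_faulty
    · intro i hi
      exact (Finset.mem_filter.1 hi).2
    · exact (S.leader_injOn _).mono fun i hi => (Finset.mem_filter.1 hi).1
  have hsub : Finset.range S.n ⊆ A 0 ∪ A 1 ∪ A 2 := by
    intro i hi
    have h := hno (N + i) (Nat.le_add_right _ _)
    simp only [ThreeCorrectLeaders, Correct] at h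
    simp only [A, Finset.mem_union, Finset.mem_filter, hi, true_and]
    rw [show N + 0 + i = N + i by ring, show N + 1 + i = N + i + 1 by ring,
      show N + 2 + i = N + i + 2 by ring]
    tauto
  have h1 := Finset.card_le_card hsub
  have h2 := Finset.card_union_le (A 0 ∪ A 1) (A 2)
  have h3 := Finset.card_union_le (A 0) (A 1)
  have h4 := S.three_f_lt
  have := hA 0
  have := hA 1
  have := hA 2
  rw [Finset.card_range] at h1
  omega

theorem exists_correct_mem {s : Finset (Fin S.n)} (hs : S.n - S.f ≤ s.card) :
    ∃ i ∈ s, S.Correct i := by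
  by_contra! h
  have h1 : s.card ≤ S.faulty.card := Finset.card_le_card fun i hi => not_not.1 (h i hi)
  have := S.card_faulty
  have := S.three_f_lt
  omega

theorem le_card_of_correct_mem {s : Finset (Fin S.n)} (hs : ∀ i, S.Correct i → i ∈ s) :
    S.n - S.f ≤ s.card := by
  have h1 : S.faultyᶜ.card ≤ s.card :=
    Finset.card_le_card fun i hi => hs i (Finset.mem_compl.1 hi)
  rw [Finset.card_compl, Fintype.card_fin] at h1
  have := S.card_faulty
  omega

end System

namespace LocalState

variable {n : ℕ} {Tx : Type*}

theorem subset_commitUpTo (ledger : List (Block Tx)) (b : Block Tx) :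
    ledger ⊆ commitUpTo ledger b :=
  List.subset_append_left _ _

theorem chain_subset_commitUpTo (ledger : List (Block Tx)) (b : Block Tx) :
    b.chain ⊆ commitUpTo ledger b := by
  intro d hd
  by_cases h : d ∈ ledger
  · exact subset_commitUpTo _ _ h
  · exact List.mem_append_right _ (by simp [hd, h])

theorem high_view_le_highAfter (s : LocalState n Tx) (b : Block Tx) :
    s.high.view ≤ (s.highAfter b).view := by
  unfold highAfter
  split_ifs with h
  · exact h
  · exact le_rfl

end LocalState

namespace Trace

variable {S : System} {Tx : Type*} {E : Trace S Tx} {R : Fin S.n}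

/-- At each step a correct replica either performs an allowed action or keeps its state. -/
theorem IsExecution.step_cases (hE : E.IsExecution) (hR : S.Correct R) (k : ℕ) :
    E.state (k + 1) R = E.state k R ∨
      ∃ a, E.act k = some (R, a) ∧ E.Allowed k R a ∧
        E.state (k + 1) R = (E.state k R).next a := by
  by_cases h : ∃ a, E.act k = some (R, a)
  · obtain ⟨a, ha⟩ := h
    exact .inr ⟨a, ha, (hE.allowed k R a ha).2, hE.step k R a ha⟩
  · exact .inl (hE.frame k R hR fun a ha => h ⟨a, ha⟩)

/-! ### Monotone components of the local state -/

theorem IsExecution.view_mono (hE : E.IsExecution) (hR : S.Correct R) :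
    Monotone fun k => (E.state k R).view := by
  refine monotone_nat_of_le_succ fun k => ?_
  rcases hE.step_cases hR k with h | ⟨a, -, hal, h⟩
  · rw [h]
  · rw [h]
    cases a <;> simp only [LocalState.next, le_refl, Nat.le_succ]
    rcases hal with hal | hal <;> omega

/-- There is at most one step in which a replica passes from below view `u` to `u` or beyond. -/
theorem IsExecution.move_unique (hE : E.IsExecution) (hR : S.Correct R) {k k' u : ℕ}
    (h : (E.state k R).view < u) (h1 : u ≤ (E.state (k + 1) R).view)
    (h' : (E.state k' R).view < u) (h1' : u ≤ (E.state (k' + 1) R).view) : k = k' := by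
  have key {k k' : ℕ} (h1 : u ≤ (E.state (k + 1) R).view) (h' : (E.state k' R).view < u) :
      k' ≤ k := by
    by_contra hlt
    exact absurd (h1.trans (hE.view_mono hR (not_le.1 hlt))) (not_le.2 h')
  exact le_antisymm (key h1' h) (key h1 h')

theorem IsExecution.inbox_mono (hE : E.IsExecution) (hR : S.Correct R) :
    Monotone fun k => (E.state k R).inbox := by
  refine monotone_nat_of_le_succ fun k => ?_
  rcases hE.step_cases hR k with h | ⟨a, -, -, h⟩
  · rw [h]
  · rw [h]
    cases a <;> simp only [LocalState.next, le_refl]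
    exact Set.subset_insert _ _

theorem IsExecution.high_view_mono (hE : E.IsExecution) (hR : S.Correct R) :
    Monotone fun k => (E.state k R).high.view := by
  refine monotone_nat_of_le_succ fun k => ?_
  rcases hE.step_cases hR k with h | ⟨a, -, hal, h⟩
  · rw [h]
  · rw [h]
    cases a <;> simp only [LocalState.next, le_refl]
    · exact hal.2.2.1 _ (.inl rfl)
    · exact LocalState.high_view_le_highAfter _ _

theorem IsExecution.pool_prefix (hE : E.IsExecution) (hR : S.Correct R) {k l : ℕ} (hkl : k ≤ l) :
    (E.state k R).pool <+: (E.state l R).pool := by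
  induction l, hkl using Nat.le_induction with
  | base => exact List.prefix_refl _
  | succ l _ ih =>
    refine ih.trans ?_
    rcases hE.step_cases hR l with h | ⟨a, -, -, h⟩
    · rw [h]
    · rw [h]
      cases a <;> simp [LocalState.next]

theorem IsExecution.globalLedger_subset (hE : E.IsExecution) (hR : S.Correct R) {k l : ℕ}
    (hkl : k ≤ l) : (E.state k R).globalLedger ⊆ (E.state l R).globalLedger := by
  induction l, hkl using Nat.le_induction with
  | base => exact List.Subset.refl _
  | succ l _ ih =>
    refine List.Subset.trans ih ?_
    rcases hE.step_cases hR l with h | ⟨a, -, -, h⟩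
    · rw [h]; exact List.Subset.refl _
    · rw [h]
      cases a <;> simp only [LocalState.next, List.Subset.refl]
      unfold LocalState.ledgerAfter
      split_ifs
      · exact LocalState.subset_commitUpTo _ _
      · exact List.Subset.refl _

/-! ### Where messages and certificates come from -/

theorem Voted.mono {k l : ℕ} (hkl : k ≤ l) {i : Fin S.n} {b : Block Tx} (h : E.Voted k i b) :
    E.Voted l i b := by
  obtain ⟨k', hk', h⟩ := h
  exact ⟨k', hk'.trans_le hkl, h⟩

theorem Certified.mono {k l : ℕ} (hkl : k ≤ l) {b : Block Tx} (h : E.Certified k b) :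
    E.Certified l b := by
  refine h.imp_right fun h => h.trans (Finset.card_le_card fun i hi => ?_)
  simp only [Finset.mem_filter, Finset.mem_univ, true_and] at hi ⊢
  exact hi.imp_right (Voted.mono hkl)

theorem IsExecution.of_mem_inbox (hE : E.IsExecution) (hR : S.Correct R) {k : ℕ} {i : Fin S.n}
    {m : Msg Tx} (h : (i, m) ∈ (E.state k R).inbox) :
    ∃ k' < k, E.WellFormed k' i m ∧ (S.Correct i → ∃ k'' < k', E.Sends k'' i R m) := by
  induction k with
  | zero => rw [hE.initial R hR] at h; exact absurd h (Set.notMem_empty _)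
  | succ k ih =>
    by_cases hk : (i, m) ∈ (E.state k R).inbox
    · obtain ⟨k', hk', h'⟩ := ih hk
      exact ⟨k', hk'.trans (Nat.lt_succ_self k), h'⟩
    · refine ⟨k, Nat.lt_succ_self k, ?_⟩
      rcases hE.step_cases hR k with h' | ⟨a, -, hal, h'⟩
      · exact absurd (h' ▸ h) hk
      · rw [h'] at h
        cases a with
        | receive j m' =>
          rcases h with h | h
          · cases h; exact hal
          · exact absurd h hk
        | _ => exact absurd h hk

theorem IsExecution.sends_correct (hE : E.IsExecution) {k : ℕ} {i j : Fin S.n} {m : Msg Tx}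
    (h : E.Sends k i j m) : S.Correct i := by
  obtain ⟨a, ha, -⟩ := h
  exact (hE.allowed k i a ha).1

/-- A `newView` message for view `u` is sent exactly in the step in which its sender moves to `u`;
it carries the highest certificate known after this step, and a share exactly if this step is a
vote. -/
theorem IsExecution.of_sends_newView (hE : E.IsExecution) {k u : ℕ} {j : Fin S.n} {c : Block Tx}
    {share : Option (Block Tx)} (h : E.Sends k R j (.newView u c share)) :
    j = S.leader u ∧ (E.state k R).view < u ∧ (E.state (k + 1) R).view = u ∧
      (E.state (k + 1) R).high = c ∧
      ∀ b, share = some b ↔ E.act k = some (R, .handle b) ∧ (E.state k R).Accepts b := by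
  obtain ⟨a, ha, h⟩ := h
  have hst := hE.step k R a ha
  rw [hst, ha]
  cases a with
  | request T => exact absurd h (Set.notMem_empty _)
  | receive i m => exact absurd h (Set.notMem_empty _)
  | propose txs c => simp [LocalState.sends] at h
  | enter v =>
    simp only [LocalState.sends, Set.mem_ofPred_eq, Prod.mk.injEq, Msg.newView.injEq] at h
    obtain ⟨hv, rfl, rfl, rfl, rfl⟩ := h
    simp [LocalState.next, hv]
  | timeout =>
    simp only [LocalState.sends, Set.mem_singleton_iff, Prod.mk.injEq, Msg.newView.injEq] at h
    obtain ⟨rfl, rfl, rfl, rfl⟩ := h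
    simp [LocalState.next]
  | handle b' =>
    simp only [LocalState.sends, Set.mem_singleton_iff, Prod.mk.injEq, Msg.newView.injEq] at h
    obtain ⟨rfl, rfl, rfl, rfl⟩ := h
    refine ⟨rfl, Nat.lt_succ_self _, rfl, rfl, fun b => ?_⟩
    unfold LocalState.shareFor
    split_ifs with hacc
    · simp only [Option.some.injEq, Prod.mk.injEq, Action.handle.injEq, true_and]
      exact ⟨fun h => ⟨h, h ▸ hacc⟩, fun h => h.1⟩
    · simp only [Option.some.injEq, Prod.mk.injEq, Action.handle.injEq, true_and,
        false_iff, not_and]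
      rintro rfl
      exact hacc

/-- A replica moves to a view only once, so it sends only one `newView` message for it. -/
theorem IsExecution.newView_unique (hE : E.IsExecution) {k k' u : ℕ} {j j' : Fin S.n}
    {c c' : Block Tx} {share share' : Option (Block Tx)}
    (h : E.Sends k R j (.newView u c share)) (h' : E.Sends k' R j' (.newView u c' share')) :
    c = c' ∧ share = share' := by
  have hR := hE.sends_correct h
  obtain ⟨-, h1, h2, h3, h4⟩ := hE.of_sends_newView h
  obtain ⟨-, h1', h2', h3', h4'⟩ := hE.of_sends_newView h'
  obtain rfl : k = k' := hE.move_unique hR h1 h2.ge h1' h2'.ge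
  exact ⟨h3.symm.trans h3', Option.ext fun b => (h4 b).trans (h4' b).symm⟩

/-- A replica that is in view `u` has sent a `newView` message for `u`. Since then its highest known
certificate has changed only if it has proposed in `u`. -/
theorem IsExecution.exists_newView (hE : E.IsExecution) (hR : S.Correct R) {k u : ℕ} (hu : 1 ≤ u)
    (hk : (E.state k R).view = u) :
    ∃ k' < k, ∃ c share, E.Sends k' R (S.leader u) (.newView u c share) ∧
      ((E.state k R).high = c ∨ ∃ p txs, E.act p = some (R, .propose txs (E.state k R).high) ∧
        (E.state p R).view = u) := by
  induction k with
  | zero => rw [hE.initial R hR] at hk; simp [LocalState.initial] at hk; omega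
  | succ k ih =>
    rcases hE.step_cases hR k with h | ⟨a, ha, hal, h⟩
    · rw [h] at hk ⊢
      obtain ⟨k', hk', h'⟩ := ih hk
      exact ⟨k', hk'.trans (Nat.lt_succ_self k), h'⟩
    · -- the three kinds of steps: into view `u`, within it by a proposal, within it otherwise
      have moved (c : Block Tx) (share : Option (Block Tx))
          (hs : (S.leader u, Msg.newView u c share) ∈ (E.state k R).sends S a)
          (hc : (E.state (k + 1) R).high = c) :
          ∃ k' < k + 1, ∃ c share, E.Sends k' R (S.leader u) (.newView u c share) ∧
            ((E.state (k + 1) R).high = c ∨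
              ∃ p txs, E.act p = some (R, .propose txs (E.state (k + 1) R).high) ∧
                (E.state p R).view = u) :=
        ⟨k, Nat.lt_succ_self k, c, share, ⟨a, ha, hs⟩, .inl hc⟩
      have stayed (hv : (E.state k R).view = u)
          (hh : (E.state (k + 1) R).high = (E.state k R).high) :
          ∃ k' < k + 1, ∃ c share, E.Sends k' R (S.leader u) (.newView u c share) ∧
            ((E.state (k + 1) R).high = c ∨
              ∃ p txs, E.act p = some (R, .propose txs (E.state (k + 1) R).high) ∧
                (E.state p R).view = u) := by
        obtain ⟨k', hk', h'⟩ := ih hv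
        exact ⟨k', hk'.trans (Nat.lt_succ_self k), hh ▸ h'⟩
      rw [h] at hk
      cases a with
      | request T => exact stayed hk (by rw [h]; rfl)
      | receive i m => exact stayed hk (by rw [h]; rfl)
      | enter v =>
        obtain rfl : v = u := hk
        rcases hal with hlt | ⟨heq, -⟩
        · exact moved _ none ⟨hlt, rfl⟩ (by rw [h]; rfl)
        · exact stayed heq (by rw [h]; rfl)
      | propose txs c =>
        obtain ⟨k', hk', c', share, hs, -⟩ := ih hk
        exact ⟨k', hk'.trans (Nat.lt_succ_self k), c', share, hs,
          .inr ⟨k, txs, by rw [h]; exact ha, hk⟩⟩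
      | handle b =>
        obtain rfl : (E.state k R).view + 1 = u := hk
        exact moved _ _ rfl (by rw [h]; rfl)
      | timeout =>
        obtain rfl : (E.state k R).view + 1 = u := hk
        exact moved _ _ rfl (by rw [h]; rfl)

/-! ### Votes and certificates -/

/-- Replica `R` processes the proposal `b` and votes for it. -/
def Votes (E : Trace S Tx) (R : Fin S.n) (b : Block Tx) : Prop :=
  ∃ k, E.act k = some (R, .handle b) ∧ (E.state k R).Accepts b

/-- A replica processes at most one proposal per view. -/
theorem IsExecution.handle_unique (hE : E.IsExecution) {k k' : ℕ} {b b' : Block Tx}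
    (h : E.act k = some (R, .handle b)) (h' : E.act k' = some (R, .handle b'))
    (hv : b.view = b'.view) : b = b' := by
  obtain ⟨hR, -, hb, -⟩ := hE.allowed _ _ _ h
  obtain ⟨-, -, hb', -⟩ := hE.allowed _ _ _ h'
  have hs : (E.state (k + 1) R).view = (E.state k R).view + 1 := by rw [hE.step _ _ _ h]; rfl
  have hs' : (E.state (k' + 1) R).view = (E.state k' R).view + 1 := by rw [hE.step _ _ _ h']; rfl
  obtain rfl : k = k' := hE.move_unique hR (Nat.lt_succ_self _) hs.ge
    (by rw [← hb', ← hv, hb]; exact Nat.lt_succ_self _) (by omega)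
  rw [h] at h'
  simpa using h'

theorem IsExecution.votes_of_voted (hE : E.IsExecution) {k : ℕ} {b : Block Tx}
    (h : E.Voted k R b) : E.Votes R b := by
  obtain ⟨k', -, j, v, c, hs⟩ := h
  exact ⟨k', ((hE.of_sends_newView hs).2.2.2.2 b).1 rfl⟩

/-- A quorum contains a correct replica, so a certified block other than the genesis block has the
vote of a correct replica. -/
theorem IsExecution.exists_votes_of_certified (hE : E.IsExecution) {k : ℕ} {b : Block Tx}
    (h : E.Certified k b) (hb : 1 ≤ b.view) : ∃ i, S.Correct i ∧ E.Votes i b := by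
  rcases h with rfl | h
  · simp [Block.view] at hb
  · obtain ⟨i, hi, hc⟩ := S.exists_correct_mem h
    simp only [Finset.mem_filter, Finset.mem_univ, true_and] at hi
    exact ⟨i, hc, hE.votes_of_voted (hi.resolve_left hc)⟩

theorem IsExecution.certified_of_forms (hE : E.IsExecution) (hR : S.Correct R) {k : ℕ}
    {b : Block Tx} (h : (E.state k R).Forms S.f b) : E.Certified k b := by
  refine .inr (h.2.trans (Finset.card_le_card fun i hi => ?_))
  simp only [LocalState.shareSenders, Finset.mem_filter, Finset.mem_univ, true_and] at hi ⊢
  obtain ⟨c, hc⟩ := hi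
  by_cases hi : S.Correct i
  · obtain ⟨k', hk', -, hsent⟩ := hE.of_mem_inbox hR hc
    obtain ⟨k'', hk'', hs⟩ := hsent hi
    exact .inr ⟨k'', hk''.trans hk', R, _, c, hs⟩
  · exact .inl (not_not.1 hi)

/-- Outside the genesis view, the highest known certificate is of a lower view than the current one.
In the genesis view it is the genesis certificate, whence the maximum. -/
theorem IsExecution.high_certified (hE : E.IsExecution) (hR : S.Correct R) (k : ℕ) :
    E.Certified k (E.state k R).high ∧
      (E.state k R).high.view < max 1 (E.state k R).view := by
  induction k with
  | zero => rw [hE.initial R hR]; exact ⟨.inl rfl, by simp [LocalState.initial, Block.view]⟩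
  | succ k ih =>
    obtain ⟨ih1, ih2⟩ := ih
    have ih1' := ih1.mono (Nat.le_succ k)
    rcases hE.step_cases hR k with h | ⟨a, -, hal, h⟩
    · rw [h]; exact ⟨ih1', ih2⟩
    · rw [h]
      cases a with
      | request T => exact ⟨ih1', ih2⟩
      | receive i m => exact ⟨ih1', ih2⟩
      | enter v =>
        refine ⟨ih1', ?_⟩
        simp only [LocalState.next]
        rcases hal with hal | hal <;> omega
      | timeout =>
        refine ⟨ih1', ?_⟩
        simp only [LocalState.next]
        omega
      | propose txs c =>
        obtain ⟨-, hknown, -⟩ := hal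
        simp only [LocalState.next]
        rcases hknown with rfl | ⟨i, share, hi⟩ | hf
        · exact ⟨ih1', ih2⟩
        · obtain ⟨k', hk', ⟨hlt, hc⟩, -⟩ := hE.of_mem_inbox hR hi
          exact ⟨hc.mono (by omega), by omega⟩
        · have := hf.1
          exact ⟨(hE.certified_of_forms hR hf).mono (Nat.le_succ k), by omega⟩
      | handle b =>
        obtain ⟨-, hbv, hb⟩ := hal
        obtain ⟨k', hk', ⟨-, hlt, hc⟩, -⟩ := hE.of_mem_inbox hR hb
        simp only [LocalState.next, LocalState.highAfter]
        split_ifs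
        · exact ⟨hc.mono (by omega), by omega⟩
        · exact ⟨ih1', by omega⟩

/-- What a correct leader extends in view `v` is certified and of a lower view. -/
theorem IsExecution.known_certified (hE : E.IsExecution) (hR : S.Correct R) {k : ℕ} {c : Block Tx}
    (hv : 1 ≤ (E.state k R).view) (h : (E.state k R).Known S.f c) :
    E.Certified k c ∧ c.view < (E.state k R).view := by
  rcases h with rfl | ⟨i, share, hi⟩ | hf
  · have := hE.high_certified hR k
    rw [max_eq_right hv] at this
    exact this
  · obtain ⟨k', hk', ⟨hlt, hc⟩, -⟩ := hE.of_mem_inbox hR hi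
    exact ⟨hc.mono hk'.le, hlt⟩
  · have := hf.1
    exact ⟨hE.certified_of_forms hR hf, by omega⟩

/-! ### Proposals of correct leaders -/

/-- Replica `R` proposes the block `B` in the step `p`. -/
def Proposes (E : Trace S Tx) (p : ℕ) (R : Fin S.n) (B : Block Tx) : Prop :=
  ∃ txs c, E.act p = some (R, .propose txs c) ∧ B = .node (E.state p R).view txs c

/-- A leader that has proposed in a view cannot enter this view again, which would reset its flag
`proposed`. -/
theorem IsExecution.after_propose (hE : E.IsExecution) {p k : ℕ} {B : Block Tx}
    (h : E.Proposes p R B) (hpk : p < k) :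
    B.view < (E.state k R).view ∨ (E.state k R).view = B.view ∧ (E.state k R).entered = true ∧
      (E.state k R).proposed = true := by
  obtain ⟨txs, c, ha, rfl⟩ := h
  obtain ⟨hR, ⟨⟨-, -, hent, -⟩, -⟩⟩ := hE.allowed _ _ _ ha
  induction k, Nat.succ_le_of_lt hpk using Nat.le_induction with
  | base => rw [Nat.succ_eq_add_one, hE.step _ _ _ ha]; exact .inr ⟨rfl, hent, rfl⟩
  | succ k hk ih =>
    rcases ih hk with ih | ⟨ih1, ih2, ih3⟩
    · exact .inl (ih.trans_le (hE.view_mono hR (Nat.le_succ k)))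
    · rcases hE.step_cases hR k with h | ⟨a, -, hal, h⟩
      · rw [h]; exact .inr ⟨ih1, ih2, ih3⟩
      · rw [h]
        simp only [Block.view] at ih1 ⊢
        cases a with
        | request T => exact .inr ⟨ih1, ih2, ih3⟩
        | receive i m => exact .inr ⟨ih1, ih2, ih3⟩
        | propose txs c => exact .inr ⟨ih1, ih2, rfl⟩
        | enter v =>
          rcases hal with hal | hal
          · exact .inl (ih1 ▸ hal)
          · simp [ih2] at hal
        | handle b => exact .inl (by simp only [LocalState.next]; omega)
        | timeout => exact .inl (by simp only [LocalState.next]; omega)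

/-- A correct leader proposes at most once per view. -/
theorem IsExecution.propose_unique (hE : E.IsExecution) {p q : ℕ} {B B' : Block Tx}
    (h : E.Proposes p R B) (h' : E.Proposes q R B') (hv : B.view = B'.view) : B = B' := by
  have key : ∀ {p q : ℕ} {B B' : Block Tx}, E.Proposes p R B → E.Proposes q R B' →
      B.view = B'.view → ¬ p < q := by
    intro p q B B' h h' hv hlt
    have h1 := hE.after_propose h hlt
    obtain ⟨txs, c, ha, rfl⟩ := h'
    obtain ⟨-, ⟨⟨-, -, -, hprop, -⟩, -⟩⟩ := hE.allowed _ _ _ ha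
    rw [hv, hprop] at h1
    simp [Block.view] at h1
  obtain rfl : p = q := le_antisymm (not_lt.1 (key h' h hv.symm)) (not_lt.1 (key h h' hv))
  obtain ⟨txs, c, ha, rfl⟩ := h
  obtain ⟨txs', c', ha', rfl⟩ := h'
  rw [ha] at ha'
  simp only [Option.some.injEq, Prod.mk.injEq, Action.propose.injEq, true_and] at ha'
  rw [ha'.1, ha'.2]

theorem IsExecution.exists_proposes_of_proposed (hE : E.IsExecution) (hR : S.Correct R) {k : ℕ}
    (h : (E.state k R).proposed = true) :
    ∃ p < k, ∃ B, E.Proposes p R B ∧ B.view = (E.state k R).view := by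
  induction k with
  | zero => rw [hE.initial R hR] at h; simp [LocalState.initial] at h
  | succ k ih =>
    have old (h1 : (E.state k R).proposed = true)
        (h2 : (E.state (k + 1) R).view = (E.state k R).view) :
        ∃ p < k + 1, ∃ B, E.Proposes p R B ∧ B.view = (E.state (k + 1) R).view := by
      obtain ⟨p, hp, h'⟩ := ih h1
      exact ⟨p, hp.trans (Nat.lt_succ_self k), h2 ▸ h'⟩
    rcases hE.step_cases hR k with h' | ⟨a, ha, -, h'⟩
    · exact old (h' ▸ h) (by rw [h'])
    · rw [h'] at h
      cases a with
      | request T => exact old h (by rw [h']; rfl)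
      | receive i m => exact old h (by rw [h']; rfl)
      | propose txs c =>
        exact ⟨k, Nat.lt_succ_self k, _, ⟨txs, c, ha, rfl⟩, by rw [h']; rfl⟩
      | _ => simp [LocalState.next] at h

/-- A proposal processed in a view with a correct leader is one that this leader has made. -/
theorem IsExecution.exists_proposes_of_handle (hE : E.IsExecution) {k : ℕ} {b : Block Tx}
    (h : E.act k = some (R, .handle b)) (hL : S.Correct (S.leader b.view)) :
    ∃ p < k, E.Proposes p (S.leader b.view) b := by
  obtain ⟨hR, -, hbv, hb⟩ := hE.allowed _ _ _ h
  obtain ⟨k', hk', -, hsent⟩ := hE.of_mem_inbox hR hb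
  rw [← hbv] at hsent
  obtain ⟨p, hp, a, ha, hs⟩ := hsent hL
  refine ⟨p, hp.trans hk', ?_⟩
  cases a with
  | propose txs c =>
    simp only [LocalState.sends, Set.mem_ofPred_eq, Msg.propose.injEq] at hs
    exact ⟨txs, c, ha, hs⟩
  | _ => simp [LocalState.sends] at hs

/-! ### Synchronized views -/

/-- Time is unbounded, so there is a last step at or before time `t`. Urgent actions that are due at
time `t` and possible after this step contradict its choice. -/
theorem IsExecution.exists_last_step (hE : E.IsExecution) {e : ℕ} {t : ℝ} (he : E.time e ≤ t) :
    ∃ l, E.time l ≤ t ∧ t < E.time (l + 1) ∧ ∀ r, E.time r ≤ t → r ≤ l := by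
  classical
  have hex : ∃ q, t < E.time q := (hE.time_unbounded.eventually_gt_atTop t).exists
  have hq := Nat.find_spec hex
  have hmin {m : ℕ} (hm : m < Nat.find hex) : E.time m ≤ t := not_lt.1 (Nat.find_min hex hm)
  have hlt (r : ℕ) (hr : E.time r ≤ t) : r < Nat.find hex := by
    by_contra hge
    exact absurd (hq.trans_le (hE.time_mono (not_lt.1 hge))) (not_lt.2 hr)
  obtain ⟨l, hl⟩ := Nat.exists_eq_add_one.2 (Nat.zero_lt_of_lt (hlt e he))
  refine ⟨l, hmin (by omega), hl ▸ hq, fun r hr => ?_⟩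
  have := hlt r hr
  omega

theorem IsExecution.mem_inbox_of_receive (hE : E.IsExecution) {r k : ℕ} {i : Fin S.n} {m : Msg Tx}
    (h : E.act r = some (R, .receive i m)) (hrk : r < k) : (i, m) ∈ (E.state k R).inbox := by
  refine hE.inbox_mono (hE.allowed _ _ _ h).1 (Nat.succ_le_of_lt hrk) ?_
  simp only [Nat.succ_eq_add_one]
  rw [hE.step _ _ _ h]
  exact Set.mem_insert _ _

/-- After entering a synchronized view, a correct replica stays there until it processes a proposal
or its timer expires. -/
theorem IsExecution.stays_in_view (hE : E.IsExecution) {vs v : ℕ} (hsync : E.SynchronizedFrom vs)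
    (hv : vs ≤ v) {e l : ℕ} (he : E.act e = some (R, .enter v)) (hel : e ≤ l)
    (hl : E.time l < E.start R v + S.τ) :
    ((E.state (l + 1) R).view = v ∧ (E.state (l + 1) R).entered = true) ∨
      ∃ h ≤ l, ∃ b, E.act h = some (R, .handle b) ∧ b.view = v := by
  have hR := (hE.allowed _ _ _ he).1
  induction l, hel using Nat.le_induction with
  | base => rw [hE.step _ _ _ he]; exact .inl ⟨rfl, rfl⟩
  | succ l _ ih =>
    rcases ih ((hE.time_mono (Nat.le_succ l)).trans_lt hl) with ⟨ih1, ih2⟩ | ⟨h, hh, ih⟩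
    · rcases hE.step_cases hR (l + 1) with h | ⟨a, ha, hal, h⟩
      · rw [h]; exact .inl ⟨ih1, ih2⟩
      · cases a with
        | request T => rw [h]; exact .inl ⟨ih1, ih2⟩
        | receive i m => rw [h]; exact .inl ⟨ih1, ih2⟩
        | propose txs c => rw [h]; exact .inl ⟨ih1, ih2⟩
        | enter w =>
          have := hsync.stays _ _ _ ha (by rw [ih1]; exact hv) ih2
          rw [ih1] at this
          exact absurd hl (not_lt.2 this)
        | timeout =>
          have := hal.2
          rw [ih1] at this
          exact absurd hl (not_lt.2 this)
        | handle b => exact .inr ⟨l + 1, le_rfl, b, ha, hal.2.1.trans ih1⟩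
    · exact .inr ⟨h, hh.trans (Nat.le_succ l), ih⟩

/-- The `newView` messages of all correct replicas reach a correct leader of a synchronized view
before its share timer expires. -/
theorem IsExecution.receives_newView (hE : E.IsExecution) {vs v : ℕ} (hvs : 1 ≤ vs)
    (hsync : E.SynchronizedFrom vs) (hv : vs ≤ v) (hL : S.Correct (S.leader v))
    (hR : S.Correct R) :
    ∃ r c share, E.act r = some (S.leader v, .receive R (.newView v c share)) ∧
      E.time r < E.start (S.leader v) v + 3 * S.Δ := by
  obtain ⟨e, he, hte⟩ := hsync.enters v hv R hR
  have hview : (E.state (e + 1) R).view = v := by rw [hE.step _ _ _ he]; rfl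
  obtain ⟨k, hk, c, share, hs, -⟩ := hE.exists_newView hR (hvs.trans hv) hview
  obtain ⟨r, -, hr, htr⟩ := hE.delivery _ _ _ _ hR hL hs
  have h1 : E.time k ≤ E.start R v := (hE.time_mono (Nat.lt_succ_iff.1 hk)).trans hte
  have h2 := max_le h1 (hsync.after_gst v hv R hR)
  have h3 := hsync.aligned v hv _ _ hL hR
  exact ⟨r, c, share, hr, by linarith⟩

/-- A correct leader of a synchronized view proposes by the time its share timer expires: until then
it cannot leave the view, and then it has enough `newView` messages. -/
theorem IsExecution.exists_proposes (hE : E.IsExecution) (hτ : 6 * S.Δ ≤ S.τ) {vs v : ℕ}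
    (hvs : 1 ≤ vs) (hsync : E.SynchronizedFrom vs) (hv : vs ≤ v) (hL : S.Correct (S.leader v)) :
    ∃ p B, E.Proposes p (S.leader v) B ∧ B.view = v ∧
      E.time p ≤ E.start (S.leader v) v + 3 * S.Δ := by
  by_contra! hno
  have hΔ := S.Δ_pos
  obtain ⟨e, he, hte⟩ := hsync.enters v hv _ hL
  obtain ⟨l, hl, hl', hlast⟩ := hE.exists_last_step
    (show E.time e ≤ E.start (S.leader v) v + 3 * S.Δ by linarith)
  have hno' (p : ℕ) (hp : p ≤ l) (B : Block Tx) (hB : B.view = v) :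
      ¬ E.Proposes p (S.leader v) B :=
    fun h => absurd ((hE.time_mono hp).trans hl) (not_le.2 (hno p B h hB))
  rcases hE.stays_in_view hsync hv he (hlast e (by linarith)) (by linarith) with
    ⟨hview, hent⟩ | ⟨h, hh, b, hb, rfl⟩
  · refine absurd (hE.propose_urgent l _ _ hL hl ⟨by rw [hview], by omega, hent, ?_, ?_, ?_⟩)
      (not_le.2 hl')
    · by_contra hprop
      obtain ⟨p, hp, B, hB, hBv⟩ := hE.exists_proposes_of_proposed hL
        (Bool.eq_true_of_not_eq_false hprop)
      exact hno' p (by omega) B (hBv.trans hview) hB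
    · refine S.le_card_of_correct_mem fun i hi => ?_
      obtain ⟨r, c, share, hr, htr⟩ := hE.receives_newView hvs hsync hv hL hi
      simp only [LocalState.newViewSenders, Finset.mem_filter, Finset.mem_univ, true_and, hview]
      exact ⟨c, share, hE.mem_inbox_of_receive hr (Nat.lt_succ_of_le (hlast r htr.le))⟩
    · rw [hview]
      exact .inr (.inr le_rfl)
  · obtain ⟨p, hp, hB⟩ := hE.exists_proposes_of_handle hb hL
    exact hno' p (by omega) b rfl hB

/-- When a correct leader of a synchronized view proposes, it can form a certificate of the
preceding view, or it has the `newView` messages of all correct replicas. -/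
theorem IsExecution.forms_or_newViews (hE : E.IsExecution) {vs v p : ℕ} {B : Block Tx}
    (hvs : 1 ≤ vs) (hsync : E.SynchronizedFrom vs) (hv : vs ≤ v)
    (hB : E.Proposes p (S.leader v) B) (hBv : B.view = v) :
    (∃ b, (E.state p (S.leader v)).Forms S.f b) ∨
      ∀ i, S.Correct i → ∃ c share,
        (i, Msg.newView v c share) ∈ (E.state p (S.leader v)).inbox ∧
          ∃ k, E.Sends k i (S.leader v) (.newView v c share) := by
  obtain ⟨txs, c, ha, rfl⟩ := hB
  obtain ⟨hL, ⟨⟨-, -, -, -, -, hready⟩, -⟩⟩ := hE.allowed _ _ _ ha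
  simp only [Block.view] at hBv
  rw [hBv] at hready
  have sent {i : Fin S.n} (hi : S.Correct i) {c : Block Tx} {share : Option (Block Tx)}
      (hm : (i, Msg.newView v c share) ∈ (E.state p (S.leader v)).inbox) :
      ∃ k, E.Sends k i (S.leader v) (.newView v c share) := by
    obtain ⟨k', -, -, hsent⟩ := hE.of_mem_inbox hL hm
    obtain ⟨k, -, hs⟩ := hsent hi
    exact ⟨k, hs⟩
  rcases hready with hf | hall | htime
  · exact .inl hf
  · refine .inr fun i hi => ?_
    have huniv := (Finset.card_eq_iff_eq_univ _).1 (hall.trans (Fintype.card_fin _).symm)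
    have hmem := huniv ▸ Finset.mem_univ i
    simp only [LocalState.newViewSenders, Finset.mem_filter, Finset.mem_univ, true_and,
      hBv] at hmem
    obtain ⟨c', share, hm⟩ := hmem
    exact ⟨c', share, hm, sent hi hm⟩
  · refine .inr fun i hi => ?_
    obtain ⟨r, c', share, hr, htr⟩ := hE.receives_newView hvs hsync hv hL hi
    have hrp : r < p := by
      by_contra hge
      have := hE.time_mono (not_lt.1 hge)
      linarith
    have hm := hE.mem_inbox_of_receive hr hrp
    exact ⟨c', share, hm, sent hi hm⟩

/-- All correct replicas vote for the block `B`. -/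
def AllVote (E : Trace S Tx) (B : Block Tx) : Prop :=
  ∀ R, S.Correct R → E.Votes R B

/-- The proposal of a correct leader in a synchronized view reaches every correct replica before its
timer expires, and it extends a certificate at least as high as any that a correct replica knows on
moving to the view. -/
theorem IsExecution.allVote (hE : E.IsExecution) (hτ : 6 * S.Δ ≤ S.τ) {vs v p : ℕ} {B : Block Tx}
    (hvs : 1 ≤ vs) (hsync : E.SynchronizedFrom vs) (hv : vs ≤ v)
    (hB : E.Proposes p (S.leader v) B) (hBv : B.view = v)
    (htp : E.time p ≤ E.start (S.leader v) v + 3 * S.Δ) : E.AllVote B := by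
  intro R hR
  have hΔ := S.Δ_pos
  have hforms := hE.forms_or_newViews hvs hsync hv hB hBv
  have hB' := hB
  obtain ⟨txs, c, ha, hBeq⟩ := hB'
  obtain ⟨hL, -, -, hmax, -⟩ := hE.allowed _ _ _ ha
  have hpv : (E.state p (S.leader v)).view = v := by rw [hBeq] at hBv; exact hBv
  have hhandle : ∃ h b, E.act h = some (R, .handle b) ∧ b.view = v := by
    by_contra! hno
    obtain ⟨e, he, hte⟩ := hsync.enters v hv R hR
    have hsend : E.Sends p (S.leader v) R (.propose B) :=
      ⟨_, ha, by simp only [LocalState.sends, Set.mem_ofPred_eq, hBeq]⟩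
    obtain ⟨r, -, hr, htr⟩ := hE.delivery _ _ _ _ hL hR hsend
    have hgst := hsync.after_gst v hv _ hL
    have h1 := hsync.aligned v hv _ _ hR hL
    have h2 : max (E.time p) S.GST ≤ E.start (S.leader v) v + 3 * S.Δ :=
      max_le htp (by linarith)
    obtain ⟨l, hl, hl', hlast⟩ := hE.exists_last_step
      (hte.trans (le_max_left _ (E.start (S.leader v) v + 4 * S.Δ)))
    have hlτ : E.time l < E.start R v + S.τ :=
      hl.trans_lt (max_lt (by linarith) (by linarith))
    have hrl := hlast r ((show E.time r ≤ E.start (S.leader v) v + 4 * S.Δ by linarith).trans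
      (le_max_right _ _))
    rcases hE.stays_in_view hsync hv he (hlast e (hte.trans (le_max_left _ _))) hlτ with
      ⟨hview, hent⟩ | ⟨h, -, b, hb, hbv⟩
    · have := hE.handle_urgent l R B hR ⟨hent, by rw [hview, hBv], by
        rw [hview]; exact hE.mem_inbox_of_receive hr (Nat.lt_succ_of_le hrl)⟩
      exact absurd (this.trans hl) (not_le.2 hl')
    · exact hno h b hb hbv
  obtain ⟨h, b, hb, hbv⟩ := hhandle
  obtain ⟨q, -, hq⟩ := hE.exists_proposes_of_handle hb (by rw [hbv]; exact hL)
  rw [hbv] at hq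
  obtain rfl : b = B := hE.propose_unique hq hB (hbv.trans hBv.symm)
  refine ⟨h, hb, ?_⟩
  have hRv : (E.state h R).view = v := by
    rw [← (hE.allowed _ _ _ hb).2.2.1]; exact hBv
  have hparent : b.parent = c := by rw [hBeq]; rfl
  unfold LocalState.Accepts
  rw [hparent]
  obtain ⟨k, -, cR, share, hs, hhigh | ⟨p', txs', hp', hp'v⟩⟩ :=
    hE.exists_newView hR (hvs.trans hv) hRv
  · rw [hhigh]
    -- the certificate `cR` that `R` had on moving to `v` is not higher than `c`
    rcases hforms with ⟨d, hd⟩ | hall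
    · have h1 := hmax d (.inr (.inr hd))
      have h2 := hd.1
      have h3 := (hE.high_certified hR (k + 1)).2
      obtain ⟨-, -, h4, h5, -⟩ := hE.of_sends_newView hs
      rw [h4, h5] at h3
      omega
    · obtain ⟨c', share', hm, k', hs'⟩ := hall R hR
      rw [(hE.newView_unique hs hs').1]
      exact hmax c' (.inr (.inl ⟨R, share', by rw [hpv]; exact hm⟩))
  · -- `R` is the leader itself, and its highest certificate is that of its proposal
    have hRL : R = S.leader v := by
      have := (hE.allowed _ _ _ hp').2.1.1
      rwa [hp'v] at this
    have hB'' : E.Proposes p' R (.node (E.state p' R).view txs' (E.state h R).high) :=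
      ⟨txs', _, hp', rfl⟩
    have := hE.propose_unique (hRL ▸ hB) hB'' (hBv.trans hp'v.symm)
    rw [← hparent, this]
    exact le_rfl

theorem IsExecution.exists_proposes_allVote (hE : E.IsExecution) (hτ : 6 * S.Δ ≤ S.τ)
    {vs v : ℕ} (hvs : 1 ≤ vs) (hsync : E.SynchronizedFrom vs) (hv : vs ≤ v)
    (hL : S.Correct (S.leader v)) :
    ∃ p B, E.Proposes p (S.leader v) B ∧ B.view = v ∧ E.AllVote B := by
  obtain ⟨p, B, hB, hBv, htp⟩ := hE.exists_proposes hτ hvs hsync hv hL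
  exact ⟨p, B, hB, hBv, hE.allVote hτ hvs hsync hv hB hBv htp⟩

/-! ### Blocks that all correct replicas vote for -/

/-- No other block of the same view can be certified. -/
theorem AllVote.eq_of_certified {B b : Block Tx} (hB : E.AllVote B) (hE : E.IsExecution) {k : ℕ}
    (hb : E.Certified k b) (hv : b.view = B.view) (hv1 : 1 ≤ B.view) : b = B := by
  obtain ⟨i, hi, h, hh, -⟩ := hE.exists_votes_of_certified hb (hv ▸ hv1)
  obtain ⟨h', hh', -⟩ := hB i hi
  exact hE.handle_unique hh hh' hv

/-- A correct leader of the next view extends the block. -/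
theorem AllVote.parent_eq {B B' : Block Tx} (hB : E.AllVote B) (hE : E.IsExecution)
    {vs v p : ℕ} (hvs : 1 ≤ vs) (hsync : E.SynchronizedFrom vs) (hv : vs ≤ v) (hBv : B.view = v)
    (hB' : E.Proposes p (S.leader (v + 1)) B') (hBv' : B'.view = v + 1) : B'.parent = B := by
  have hforms := hE.forms_or_newViews hvs hsync (hv.trans (Nat.le_succ v)) hB' hBv'
  obtain ⟨txs, c, ha, rfl⟩ := hB'
  obtain ⟨hL, -, hknown, hmax, -⟩ := hE.allowed _ _ _ ha
  simp only [Block.view] at hBv'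
  obtain ⟨hc, hcv⟩ := hE.known_certified hL (by omega) hknown
  have hge : ∃ d, (E.state p (S.leader (v + 1))).Forms S.f d := by
    rcases hforms with hd | hall
    · exact hd
    · refine ⟨B, by rw [hBv, hBv'], S.le_card_of_correct_mem fun i hi => ?_⟩
      obtain ⟨c', share, hm, k, hs⟩ := hall i hi
      -- the only `newView` message of `i` for view `v + 1` carries its share for `B`
      obtain ⟨h, hh, hacc⟩ := hB i hi
      have hiv : (E.state h i).view = v := by rw [← (hE.allowed _ _ _ hh).2.2.1]; exact hBv
      have hvote : E.Sends h i (S.leader (v + 1))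
          (.newView (v + 1) ((E.state h i).highAfter B) (some B)) := by
        refine ⟨_, hh, ?_⟩
        simp only [LocalState.sends, LocalState.shareFor, if_pos hacc, hiv, Set.mem_singleton_iff]
      rw [(hE.newView_unique hs hvote).2] at hm
      simp only [LocalState.shareSenders, Finset.mem_filter, Finset.mem_univ, true_and, hBv']
      exact ⟨c', hm⟩
  obtain ⟨d, hd⟩ := hge
  have h1 := hmax d (.inr (.inr hd))
  have h2 := hd.1
  change c = B
  exact hB.eq_of_certified hE hc (by omega) (by omega)

/-- A vote for `B'` adopts the certificate of its parent, and the highest known certificate never gets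
lower. -/
theorem AllVote.le_high_view {B' : Block Tx} (hB' : E.AllVote B') (hE : E.IsExecution)
    (hR : S.Correct R) {k : ℕ} (hk : B'.view < (E.state k R).view) :
    B'.parent.view ≤ (E.state k R).high.view := by
  obtain ⟨h, hh, hacc⟩ := hB' R hR
  have hhk : h < k := by
    by_contra hge
    have h1 : (E.state k R).view ≤ (E.state h R).view := hE.view_mono hR (not_lt.1 hge)
    have h2 := (hE.allowed _ _ _ hh).2.2.1
    omega
  refine le_trans ?_ (hE.high_view_mono hR (Nat.succ_le_of_lt hhk))
  simp only [Nat.succ_eq_add_one]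
  rw [hE.step _ _ _ hh]
  simp [LocalState.next, LocalState.highAfter, hacc]

/-- Safety: if all correct replicas vote for `B'` and for its parent of the preceding view, every
certified block from this view on lies on the branch of the parent. A correct replica that votes
after it has processed `B'` knows the certificate of the parent. -/
theorem AllVote.chainTxs_subset {B' : Block Tx} (hB' : E.AllVote B') (hB : E.AllVote B'.parent)
    (hE : E.IsExecution) (h1 : 1 ≤ B'.parent.view) (hsucc : B'.view = B'.parent.view + 1) :
    ∀ {b : Block Tx} {k : ℕ}, E.Certified k b → B'.parent.view ≤ b.view →
      B'.parent.chainTxs ⊆ b.chainTxs := by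
  intro b
  induction hn : b.view using Nat.strong_induction_on generalizing b with
  | _ n ih =>
    intro k hb hle
    obtain ⟨i, hi, h, hh, hacc⟩ := hE.exists_votes_of_certified hb (by omega)
    obtain ⟨-, -, hbv, hmem⟩ := hE.allowed _ _ _ hh
    obtain ⟨k', -, ⟨-, hlt, hc⟩, -⟩ := hE.of_mem_inbox hi hmem
    rcases Nat.lt_trichotomy b.view B'.view with hcase | hcase | hcase
    · rw [hB.eq_of_certified hE hb (by omega) h1]
      exact List.Subset.refl _
    · rw [hB'.eq_of_certified hE hb hcase (by omega)]
      exact B'.chainTxs_parent_subset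
    · have h2 := hB'.le_high_view hE hi (k := h) (by omega)
      have h3 : (E.state h i).high.view ≤ b.parent.view := hacc
      exact List.Subset.trans (ih _ (by omega) rfl hc (h2.trans h3)) b.chainTxs_parent_subset

/-! ### Liveness -/

/-- Three consecutive correct leaders in synchronized views: the block of the first one is committed
by all correct replicas on processing the proposal of the third, and correct leaders extend it in
all views from the third on. -/
theorem IsExecution.exists_committed (hE : E.IsExecution) (hτ : 6 * S.Δ ≤ S.τ) {vs v : ℕ}
    (hvs : 1 ≤ vs) (hsync : E.SynchronizedFrom vs) (hv : vs ≤ v) (hL : S.ThreeCorrectLeaders v) :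
    ∃ p B, E.Proposes p (S.leader v) B ∧ B.view = v ∧
      (∀ R, S.Correct R → ∃ k b, E.act k = some (R, .handle b) ∧ b.view = v + 2 ∧
        B.chain ⊆ (E.state (k + 1) R).globalLedger) ∧
      ∀ R q C, E.Proposes q R C → v + 2 ≤ C.view → B.chainTxs ⊆ C.parent.chainTxs := by
  obtain ⟨hL0, hL1, hL2⟩ := hL
  obtain ⟨p, B, hp, hv0, hB⟩ := hE.exists_proposes_allVote hτ hvs hsync hv hL0
  obtain ⟨p1, B1, hp1, hv1, hB1⟩ :=
    hE.exists_proposes_allVote hτ hvs hsync (v := v + 1) (by omega) hL1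
  obtain ⟨p2, B2, hp2, hv2, hB2⟩ :=
    hE.exists_proposes_allVote hτ hvs hsync (v := v + 2) (by omega) hL2
  obtain rfl := hB.parent_eq hE hvs hsync hv hv0 hp1 hv1
  obtain rfl := hB1.parent_eq hE hvs hsync (v := v + 1) (by omega) hv1 hp2 hv2
  refine ⟨p, _, hp, hv0, fun R hR => ?_, fun R q C hC hCv => ?_⟩
  · obtain ⟨k, hk, -⟩ := hB2 R hR
    refine ⟨k, B2, hk, hv2, ?_⟩
    rw [hE.step _ _ _ hk]
    simp only [LocalState.next, LocalState.ledgerAfter]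
    rw [if_pos (by omega)]
    exact LocalState.chain_subset_commitUpTo _ _
  · obtain ⟨txs, c, ha, rfl⟩ := hC
    obtain ⟨hR, ⟨-, hview, -⟩, hknown, hmax, -⟩ := hE.allowed _ _ _ ha
    simp only [Block.view] at hCv
    refine hB1.chainTxs_subset hB hE (by omega) (by omega)
      (hE.known_certified hR hview hknown).1 ?_
    exact (hB1.le_high_view hE hR (k := q) (by omega)).trans (hmax _ (.inl rfl))

open Classical in
/-- The transactions of a fixed initial segment `P` of the pool that are not in the chain of `b`. -/
noncomputable def missing (P : List Tx) (b : Block Tx) : List Tx :=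
  P.filter fun T => T ∉ b.chainTxs

/-- A proposal of a correct leader takes up the first missing transaction of an initial segment of
its pool, if there is one. -/
theorem IsExecution.missing_length_lt (hE : E.IsExecution) {p : ℕ} {B : Block Tx}
    (hB : E.Proposes p R B) {P : List Tx} (hP : P <+: (E.state p R).pool)
    (hne : missing P B.parent ≠ []) :
    (missing P B).length < (missing P B.parent).length := by
  classical
  obtain ⟨txs, c, ha, rfl⟩ := hB
  obtain ⟨-, -, -, -, m, hm, htxs⟩ := hE.allowed _ _ _ ha
  obtain ⟨P', hP'⟩ := hP
  obtain ⟨T, l, hTl⟩ := List.exists_cons_of_ne_nil hne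
  have hT : T ∈ txs := by
    have hpend : (E.state p R).pending c = T :: (l ++ P'.filter fun T => T ∉ c.chainTxs) := by
      unfold LocalState.pending
      rw [← hP', List.filter_append]
      change missing P c ++ _ = _
      rw [show missing P c = T :: l from hTl, List.cons_append]
    obtain ⟨m, rfl⟩ := Nat.exists_eq_add_of_le' hm
    rw [htxs, hpend, List.take_succ_cons]
    exact List.mem_cons_self
  have hsub : missing P (.node (E.state p R).view txs c) =
      (missing P c).filter fun T => T ∉ txs := by
    unfold missing
    rw [List.filter_filter]
    congr 1
    funext T
    simp [Block.chainTxs, and_comm]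
  change (missing P (.node (E.state p R).view txs c)).length < (missing P c).length
  rw [hsub]
  refine List.length_filter_lt_length_iff_exists.2 ⟨T, ?_, by simpa using hT⟩
  rw [show missing P c = T :: l from hTl]
  exact List.mem_cons_self

theorem missing_length_le (P : List Tx) {b b' : Block Tx} (h : b.chainTxs ⊆ b'.chainTxs) :
    (missing P b').length ≤ (missing P b).length := by
  classical
  refine (List.monotone_filter_right P fun T hT => ?_).length_le
  simp only [decide_eq_true_eq] at hT ⊢
  exact fun h' => hT (h h')

/-- In the later views led by a correct leader that receives `T`, followed by two correct leaders,
the transactions up to `T` in its pool go into the chain one after the other. -/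
theorem IsExecution.eventuallyCommitted (hE : E.IsExecution) (hτ : 6 * S.Δ ≤ S.τ) {vs v : ℕ}
    (hvs : 1 ≤ vs) (hsync : E.SynchronizedFrom vs) (hL : S.ThreeCorrectLeaders v) {T : Tx}
    (hT : E.Receives (S.leader v) T) : E.EventuallyCommitted T := by
  classical
  obtain ⟨k₀, hk₀⟩ := hT
  set L := S.leader v with hLdef
  set P := (E.state (k₀ + 1) L).pool with hPdef
  have hTP : T ∈ P := by
    rw [hPdef, hE.step _ _ _ hk₀]
    simp [LocalState.next]
  -- the view `v + n w` has the leader of view `v`, and is late enough for large `w`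
  have hLc : S.Correct L := hL.1
  set w₀ := vs + (E.state (k₀ + 1) L).view + 1 with hw₀
  have late (w : ℕ) (hw : w₀ ≤ w) : w₀ ≤ v + S.n * w :=
    hw.trans ((Nat.le_mul_of_pos_left w S.n_pos).trans (Nat.le_add_left _ _))
  have hround (j : ℕ) : ∃ w ≥ w₀, ∃ p B, E.Proposes p L B ∧ B.view = v + S.n * w ∧
      (∀ R, S.Correct R → ∃ k, B.chain ⊆ (E.state k R).globalLedger) ∧
      (∀ R q C, E.Proposes q R C → v + S.n * w + 2 ≤ C.view →
        B.chainTxs ⊆ C.parent.chainTxs) ∧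
      (missing P B).length ≤ P.length - j := by
    induction j with
    | zero =>
      obtain ⟨p, B, hp, hBv, hcomm, hext⟩ := hE.exists_committed hτ hvs hsync
        (v := v + S.n * w₀) (le_trans (by omega) (late w₀ le_rfl)) (hL.add_mul w₀)
      rw [S.leader_add_mul] at hp
      refine ⟨w₀, le_rfl, p, B, hp, hBv, fun R hR => ?_, hext, List.length_filter_le _ _⟩
      obtain ⟨k, b, -, -, h⟩ := hcomm R hR
      exact ⟨k + 1, h⟩
    | succ j ih =>
      obtain ⟨w, hw, p, B, hp, hBv, -, hext, hlen⟩ := ih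
      obtain ⟨p', B', hp', hBv', hcomm', hext'⟩ := hE.exists_committed hτ hvs hsync
        (v := v + S.n * (w + 2)) (le_trans (by omega) (late (w + 2) (by omega))) (hL.add_mul _)
      rw [S.leader_add_mul, ← hLdef] at hp'
      refine ⟨w + 2, by omega, p', B', hp', hBv', fun R hR => ?_, hext', ?_⟩
      · obtain ⟨k, b, -, -, h⟩ := hcomm' R hR
        exact ⟨k + 1, h⟩
      have hlate := late (w + 2) (by omega)
      have hB'B := hext L p' B' hp' (by rw [hBv']; have := S.n_pos; nlinarith)
      have hpool : P <+: (E.state p' L).pool := by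
        refine hE.pool_prefix hLc ?_
        by_contra hlt
        have h1 := hE.view_mono hLc (not_le.1 hlt).le
        obtain ⟨txs, c, -, rfl⟩ := hp'
        simp only [Block.view] at h1 hBv'
        omega
      have h1 := missing_length_le P hB'B
      have h2 := missing_length_le P B'.chainTxs_parent_subset
      by_cases hne : missing P B'.parent = []
      · rw [hne] at h2
        simp only [List.length_nil] at h2
        omega
      · have := hE.missing_length_lt hp' hpool hne
        omega
  obtain ⟨w, -, p, B, -, -, hcomm, -, hlen⟩ := hround P.length
  have hTB : T ∈ B.chainTxs := by
    have hnil : missing P B = [] := List.length_eq_zero_iff.1 (by omega)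
    have := (List.filter_eq_nil_iff.1 hnil) T hTP
    simpa using this
  obtain ⟨d, hd, hTd⟩ := Block.exists_mem_chain_of_mem_chainTxs hTB
  intro R hR
  obtain ⟨K, hK⟩ := hcomm R hR
  exact ⟨K, fun k hk => ⟨d, hE.globalLedger_subset hR hk (hK hd), hTd⟩⟩

end Trace
end HotStuff1

theorem mainTheorem2 {Tx : Type*} (S : HotStuff1.System) (hτ : 6 * S.Δ ≤ S.τ)
    (E : HotStuff1.Trace S Tx) (hE : E.IsExecution)
    (vs : ℕ) (hvs : 1 ≤ vs) (hsync : E.SynchronizedFrom vs) :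
    -- every transaction that reaches the correct replicas is eventually committed by all of them
    (∀ T : Tx, (∀ R, S.Correct R → E.Receives R T) → E.EventuallyCommitted T) ∧
    -- it suffices that it reaches the first of three consecutive correct leaders
    (∀ T : Tx, ∀ v, S.ThreeCorrectLeaders v → E.Receives (S.leader v) T →
      E.EventuallyCommitted T) ∧
    -- three consecutive correct leaders occur again and again
    (∀ N, ∃ v ≥ N, S.ThreeCorrectLeaders v) ∧
    -- from the first synchronized view on, the first of them proposes a block, which every correct
    -- replica has committed once it has processed the proposal of the third
    (∀ v ≥ vs, S.ThreeCorrectLeaders v →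
      ∃ k txs c, E.act k = some (S.leader v, HotStuff1.Action.propose txs c) ∧
        (E.state k (S.leader v)).view = v ∧
        ∀ R, S.Correct R → ∃ k' b', E.act k' = some (R, HotStuff1.Action.handle b') ∧
          b'.view = v + 2 ∧
          HotStuff1.Block.node v txs c ∈ (E.state (k' + 1) R).globalLedger) := by
  refine ⟨fun T hT => ?_, fun T v hL hT => hE.eventuallyCommitted hτ hvs hsync hL hT,
    S.exists_threeCorrectLeaders, fun v hv hL => ?_⟩
  · obtain ⟨v, -, hL⟩ := S.exists_threeCorrectLeaders 0
    exact hE.eventuallyCommitted hτ hvs hsync hL (hT _ hL.1)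
  · obtain ⟨p, B, ⟨txs, c, ha, rfl⟩, hBv, hcomm, -⟩ := hE.exists_committed hτ hvs hsync hv hL
    simp only [HotStuff1.Block.view] at hBv
    rw [hBv] at hcomm
    refine ⟨p, txs, c, ha, hBv, fun R hR => ?_⟩
    obtain ⟨k, b, hk, hbv, h⟩ := hcomm R hR
    exact ⟨k, b, hk, hbv, h (HotStuff1.Block.self_mem_chain _)⟩
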